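/- Let $k \in \mathbb{N}_0$ and $r \in [0,\infty)$ be fixed with $\max\{k,r\} > 0$. For integers $0\le m\le n$ define the $r$-Stirling numbers with real parameter $r$ by $$\left[{n\atop m}\right]_r = \sum_{j=m}^n \left[{n\atop j}\right] \binom{j}{m} r^{j-m}, \qquad \left\{{n\atop m}\right\}_r = \sum_{j=m}^n \binom{n}{j} \left\{{j\atop m}\right\} r^{n-j},$$ where $\left[{n\atop j}\right]$ and $\left\{{j\atop m}\right\}$ are the (unsigned) Stirling numbers of the first and second kind and $0^0=1$, and, for $n\ge k$, let $L(n,k)_r = \sum_{j=k}^n \left[{n\atop j}\right]_r \left\{{j\atop k}\right\}_r$. For every $n \ge \max\{k,1\}$ let $\mathrm{Lah}(n,k)_r$ be a random variable with the $r$-Lah distribution, that is, $$\mathbb{P}[\mathrm{Lah}(n,k)_r = j] = \frac{1}{L(n,k)_r}\left[{n\atop j}\right]_r \left\{{j\atop k}\right\}_r, \qquad j \in \{k, k+1, \dots, n\}.$$ Then $$\frac{\mathrm{Lah}(n,k)_r - (k+r)\log n}{\sqrt{(k+r)\log n}} \longrightarrow \mathcal{N}(0,1) \quad\text{in distribution as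 } n \to \infty.$$ -/

import Mathlib

open MeasureTheory ProbabilityTheory Filter

noncomputable section

/-- The `r`-Stirling number of the first kind for a real parameter `r`,
`∑_{j=k}^n [n, j] (j choose k) r^(j-k)`. It is `0` for `k > n` (empty sum). -/
def rStirlingFirst (r : ℝ) (n k : ℕ) : ℝ :=
  ∑ j ∈ Finset.Icc k n, (Nat.stirlingFirst n j : ℝ) * (j.choose k : ℝ) * r ^ (j - k)

/-- The `r`-Stirling number of the second kind for a real parameter `r`,
`∑_{j=k}^n (n choose j) {j, k} r^(n-j)`. It is `0` for `k > n` (empty sum). -/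
def rStirlingSecond (r : ℝ) (n k : ℕ) : ℝ :=
  ∑ j ∈ Finset.Icc k n, (n.choose j : ℝ) * (Nat.stirlingSecond j k : ℝ) * r ^ (n - j)

/-- The `r`-Lah number `L(n, k)_r`. -/
def rLah (r : ℝ) (n k : ℕ) : ℝ :=
  ∑ j ∈ Finset.Icc k n, rStirlingFirst r n j * rStirlingSecond r j k

/-- The real random variable `X` on the probability space `(Ω, P)` has the `r`-Lah distribution
with parameters `n`, `k` and `r`. (The probabilities on `{k, …, n}` add up to `1` for admissible
parameters, so they determine the law of `X`.) -/
structure HasRLahDistribution {Ω : Type*} [MeasurableSpace Ω] (P : Measure Ω) (X : Ω → ℝ)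
    (n k : ℕ) (r : ℝ) : Prop where
  aemeasurable : AEMeasurable X P
  prob_eq : ∀ j ∈ Finset.Icc k n,
    P.real {ω | X ω = (j : ℝ)} = rStirlingFirst r n j * rStirlingSecond r j k / rLah r n k

end

open scoped Topology

/-! The proof computes characteristic functions from the generating polynomial of the weights.
Inclusion–exclusion for the second-kind numbers and rising factorials for the first kind give
(`factorial_mul_rLahGen`) a signed sum over i ≤ k of the products ∏ ((r+i)x + r + m), m < n.

On |x| = 1 the term i = k dominates: divided by ∏ (2r+k+m), its value at x = 1, every other term is
O(1/n) (`tendsto_rLahGen_sub`). Along x_n → 1 the dominant ratio is asymptotic to exp((k+r)(x_n-1)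
log n) (`tendsto_prod_add_div_prod_mul_exp`), the generating function of a Poisson law with mean
(k+r) log n. The classical Poisson limit and Lévy's continuity theorem conclude. -/

/-! ### Generating functions of Stirling and r-Stirling numbers -/

theorem sum_stirlingFirst_mul_pow {R : Type*} [CommRing R] (n : ℕ) (y : R) :
    ∑ j ∈ Finset.range (n + 1), (Nat.stirlingFirst n j : R) * y ^ j =
      ∏ m ∈ Finset.range n, (y + m) := by
  induction n with
  | zero => simp
  | succ n ih =>
    rw [Finset.prod_range_succ, ← ih, Finset.sum_range_succ']
    have h : ∑ j ∈ Finset.range (n + 1), (Nat.stirlingFirst n (j + 1) : R) * y ^ (j + 1) * n =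
        ∑ j ∈ Finset.range (n + 1), (Nat.stirlingFirst n j : R) * y ^ j * n := by
      -- Both boundary terms vanish; at index 0 either the factor `n` or the Stirling number is
      -- zero.
      rw [Finset.sum_range_succ, Nat.stirlingFirst_eq_zero_of_lt (Nat.lt_succ_self n),
        Finset.sum_range_succ' (fun j => (Nat.stirlingFirst n j : R) * y ^ j * n)]
      cases n <;> simp
    rw [mul_add, Finset.sum_mul, Finset.sum_mul, ← h, ← Finset.sum_add_distrib]
    simp only [Nat.stirlingFirst_succ_zero, Nat.cast_zero, zero_mul, add_zero]
    refine Finset.sum_congr rfl fun j _ => ?_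
    rw [Nat.stirlingFirst_succ_succ]
    push_cast
    ring

theorem sum_rStirlingFirst_mul_pow (r : ℝ) (n : ℕ) (y : ℂ) :
    ∑ j ∈ Finset.range (n + 1), (rStirlingFirst r n j : ℂ) * y ^ j =
      ∏ m ∈ Finset.range n, (y + r + m) := by
  rw [← sum_stirlingFirst_mul_pow]
  simp only [rStirlingFirst, add_pow, Finset.mul_sum]
  push_cast
  simp only [Finset.sum_mul]
  rw [Finset.sum_comm' (t' := Finset.range (n + 1)) (s' := fun l => Finset.range (l + 1))]
  · refine Finset.sum_congr rfl fun l _ => Finset.sum_congr rfl fun j _ => ?_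
    ring
  · intro x y
    simp only [Finset.mem_range, Finset.mem_Icc]
    omega

theorem factorial_mul_stirlingSecond {R : Type*} [CommRing R] (n k : ℕ) :
    (k.factorial : R) * Nat.stirlingSecond n k =
      ∑ i ∈ Finset.range (k + 1), (-1) ^ (k + i) * (k.choose i : R) * (i : R) ^ n := by
  induction n generalizing k with
  | zero =>
    cases k with
    | zero => simp
    | succ k =>
      simp only [Nat.stirlingSecond_zero_succ, Nat.cast_zero, mul_zero, pow_zero, mul_one]
      have h := add_pow (-1 : R) 1 (k + 1)
      simp only [neg_add_cancel, one_pow, mul_one, zero_pow (Nat.succ_ne_zero k)] at h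
      simp only [pow_add (-1 : R) (k + 1), mul_assoc]
      rw [← Finset.mul_sum, ← h, mul_zero]
  | succ n ih =>
    cases k with
    | zero => simp
    | succ k =>
      have h1 := ih (k + 1)
      have h2 := ih k
      rw [Nat.stirlingSecond_succ_succ]
      have h3 : ∑ i ∈ Finset.range (k + 1), (-1) ^ (k + i) * (k.choose i : R) * (i : R) ^ n =
          ∑ i ∈ Finset.range (k + 1 + 1), (-1) ^ (k + i) * (k.choose i : R) * (i : R) ^ n := by
        rw [Finset.sum_range_succ _ (k + 1)]
        simp
      rw [h3] at h2
      have key : ((k + 1).factorial : R) * ((k + 1) * Nat.stirlingSecond n (k + 1) +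
          Nat.stirlingSecond n k) = (k + 1) * (((k + 1).factorial : R) *
            Nat.stirlingSecond n (k + 1)) + (k + 1) * ((k.factorial : R) *
            Nat.stirlingSecond n k) := by
        rw [Nat.factorial_succ]
        push_cast
        ring
      push_cast at key ⊢
      rw [key, h1, h2, Finset.mul_sum, Finset.mul_sum, ← Finset.sum_add_distrib]
      refine Finset.sum_congr rfl fun i hi => ?_
      have hc : ((k : R) + 1) * k.choose i = (k + 1 - i) * (k + 1).choose i := by
        have hi' : i ≤ k + 1 := by simpa [Nat.lt_succ_iff] using hi
        have h4 := Nat.choose_mul_succ_eq k i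
        have h5 : ((k.choose i * (k + 1) : ℕ) : R) = ((k + 1).choose i * (k + 1 - i) : ℕ) :=
          congrArg _ h4
        push_cast [Nat.cast_sub hi'] at h5
        linear_combination h5
      linear_combination (-1) ^ (k + i) * (i : R) ^ n * hc

/-- Inclusion–exclusion under the sum over j; the binomial theorem then collects the powers of i and
r. -/
theorem factorial_mul_rStirlingSecond (r : ℝ) (n k : ℕ) :
    (k.factorial : ℝ) * rStirlingSecond r n k =
      ∑ i ∈ Finset.range (k + 1), (-1) ^ (k + i) * (k.choose i : ℝ) * (r + i) ^ n := by
  have h : rStirlingSecond r n k =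
      ∑ j ∈ Finset.range (n + 1), (n.choose j : ℝ) * Nat.stirlingSecond j k * r ^ (n - j) := by
    refine Finset.sum_subset (fun j hj => ?_) fun j hj hj' => ?_
    · simp only [Finset.mem_Icc, Finset.mem_range] at *
      omega
    · rw [Nat.stirlingSecond_eq_zero_of_lt]
      · simp
      · simp only [Finset.mem_Icc, Finset.mem_range] at *
        omega
  rw [h, Finset.mul_sum]
  calc _ = ∑ j ∈ Finset.range (n + 1), ∑ i ∈ Finset.range (k + 1),
        (-1) ^ (k + i) * (k.choose i : ℝ) * ((i : ℝ) ^ j * r ^ (n - j) * n.choose j) := by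
        refine Finset.sum_congr rfl fun j _ => ?_
        have := factorial_mul_stirlingSecond (R := ℝ) j k
        calc _ = (k.factorial * Nat.stirlingSecond j k : ℝ) * (r ^ (n - j) * n.choose j) := by ring
          _ = _ := by
            rw [this, Finset.sum_mul]
            exact Finset.sum_congr rfl fun i _ => by ring
    _ = _ := by
        rw [Finset.sum_comm]
        refine Finset.sum_congr rfl fun i _ => ?_
        rw [← Finset.mul_sum, add_comm r, add_pow]

/-- The generating polynomial of the weights of the `r`-Lah distribution, evaluated at `x`. -/
noncomputable def rLahGen (r : ℝ) (n k : ℕ) (x : ℂ) : ℂ :=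
  ∑ j ∈ Finset.Icc k n, ((rStirlingFirst r n j * rStirlingSecond r j k : ℝ) : ℂ) * x ^ j

theorem rLahGen_one (r : ℝ) (n k : ℕ) : rLahGen r n k 1 = rLah r n k := by
  simp [rLahGen, rLah]

theorem factorial_mul_rLahGen (r : ℝ) (n k : ℕ) (x : ℂ) :
    (k.factorial : ℂ) * rLahGen r n k x =
      ∑ i ∈ Finset.range (k + 1), (-1) ^ (k + i) * (k.choose i : ℂ) *
        ∏ m ∈ Finset.range n, ((r + i) * x + r + m) := by
  have h : rLahGen r n k x = ∑ j ∈ Finset.range (n + 1),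
      ((rStirlingFirst r n j * rStirlingSecond r j k : ℝ) : ℂ) * x ^ j := by
    refine Finset.sum_subset (fun j hj => ?_) fun j hj hj' => ?_
    · simp only [Finset.mem_Icc, Finset.mem_range] at *
      omega
    · have : j < k := by
        simp only [Finset.mem_Icc, Finset.mem_range] at *
        omega
      simp [rStirlingSecond, Finset.Icc_eq_empty_of_lt this]
  simp only [← sum_rStirlingFirst_mul_pow, Finset.mul_sum, h]
  rw [Finset.sum_comm]
  refine Finset.sum_congr rfl fun j _ => ?_
  have h2 := congrArg (fun a : ℝ => (a : ℂ)) (factorial_mul_rStirlingSecond r j k)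
  push_cast at h2 ⊢
  calc _ = (k.factorial * rStirlingSecond r j k : ℂ) * (rStirlingFirst r n j * x ^ j) := by ring
    _ = _ := by
      rw [h2, Finset.sum_mul]
      exact Finset.sum_congr rfl fun i _ => by rw [mul_pow]; ring

/-! ### Asymptotics of shifted factorials and the Poisson limit -/

theorem exists_sum_inv_sq_le {a : ℝ} (ha : 0 < a) :
    ∃ C, ∀ n : ℕ, ∑ m ∈ Finset.range n, ((a + m) ^ 2)⁻¹ ≤ C := by
  have hs : Summable fun m : ℕ => ((a + m) ^ 2)⁻¹ := by
    have h := (Real.summable_one_div_nat_add_rpow a 2).2 (by norm_num)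
    refine h.congr fun m => ?_
    rw [abs_of_pos (by positivity)]
    norm_num [add_comm]
  exact ⟨_, fun n => hs.sum_le_tsum _ fun m _ => by positivity⟩

theorem exists_abs_sum_inv_sub_log_le {a : ℝ} (ha : 0 < a) :
    ∃ C, ∀ n : ℕ, |∑ m ∈ Finset.range n, (a + m)⁻¹ - Real.log n| ≤ C := by
  obtain ⟨A, hA⟩ := exists_sum_inv_sq_le ha
  obtain ⟨B, hB⟩ := exists_sum_inv_sq_le one_pos
  have hE : Tendsto (fun n : ℕ => (harmonic n : ℝ) - Real.log n) atTop
      (𝓝 Real.eulerMascheroniConstant) := Real.tendsto_harmonic_sub_log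
  obtain ⟨E, hE⟩ := (hE.abs.bddAbove_range)
  refine ⟨|1 - a| * (A + B) + E, fun n => ?_⟩
  have h1 : |∑ m ∈ Finset.range n, (a + m)⁻¹ - (harmonic n : ℝ)| ≤ |1 - a| * (A + B) := by
    rw [harmonic]
    push_cast
    rw [← Finset.sum_sub_distrib]
    refine (Finset.abs_sum_le_sum_abs _ _).trans ?_
    calc _ ≤ ∑ m ∈ Finset.range n, |1 - a| * (((a + m) ^ 2)⁻¹ + ((1 + m : ℝ) ^ 2)⁻¹) := by
          refine Finset.sum_le_sum fun m _ => ?_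
          have hp : 0 < a + m := by positivity
          have hq : (0 : ℝ) < 1 + m := by positivity
          have : (a + m)⁻¹ - ((m : ℝ) + 1)⁻¹ = (1 - a) * ((a + m)⁻¹ * (1 + m : ℝ)⁻¹) := by
            rw [add_comm (m : ℝ) 1]
            field_simp
            ring
          rw [this, abs_mul, abs_of_pos (a := (a + m)⁻¹ * (1 + m : ℝ)⁻¹) (by positivity)]
          gcongr
          rw [← inv_pow, ← inv_pow]
          -- This is uv ≤ u² + v².
          nlinarith [sq_nonneg ((a + m)⁻¹ - (1 + m : ℝ)⁻¹), inv_pos.2 hp, inv_pos.2 hq,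
            sq_nonneg ((a + m)⁻¹ + (1 + m : ℝ)⁻¹)]
      _ ≤ _ := by
          rw [← Finset.mul_sum, Finset.sum_add_distrib]
          gcongr
          exacts [hA n, hB n]
  have h2 : |(harmonic n : ℝ) - Real.log n| ≤ E := hE ⟨n, rfl⟩
  calc _ ≤ _ := abs_sub_le _ (harmonic n : ℝ) _
    _ ≤ _ := add_le_add h1 h2

/-- A form of Γ(a+δ+n)/Γ(a+n) ~ n^δ uniform enough for varying δ → 0. Taking logarithms, the linear
terms sum to δ log n + O(δ) and the quadratic remainders to O(δ²). -/
theorem tendsto_prod_add_div_prod_mul_exp {a : ℝ} (ha : 0 < a) {δ : ℕ → ℂ}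
    (hδ : Tendsto δ atTop (𝓝 0)) :
    Tendsto (fun n : ℕ => (∏ m ∈ Finset.range n, (a + m + δ n)) /
      (∏ m ∈ Finset.range n, ((a : ℂ) + m)) * Complex.exp (-(δ n * Real.log n)))
      atTop (𝓝 1) := by
  obtain ⟨A, hA⟩ := exists_sum_inv_sq_le ha
  obtain ⟨B, hB⟩ := exists_abs_sum_inv_sub_log_le ha
  have hpos : ∀ m : ℕ, 0 < a + m := fun m => by positivity
  have hne : ∀ m : ℕ, (a : ℂ) + m ≠ 0 := fun m => by
    exact_mod_cast (hpos m).ne'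
  let e : ℕ → ℂ := fun n =>
    ∑ m ∈ Finset.range n, Complex.log (1 + δ n / (a + m)) - δ n * Real.log n
  have he : Tendsto e atTop (𝓝 0) := by
    have hlim : Tendsto (fun n => ‖δ n‖ ^ 2 * A + ‖δ n‖ * B) atTop (𝓝 0) := by
      have h := hδ.norm
      rw [norm_zero] at h
      simpa using ((h.pow 2).mul_const A).add (h.mul_const B)
    refine squeeze_zero_norm' ?_ hlim
    have hsmall : ∀ᶠ n in atTop, ‖δ n‖ < a / 2 := by
      have h := hδ.norm
      rw [norm_zero] at h
      exact h.eventually (gt_mem_nhds (by positivity))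
    filter_upwards [hsmall] with n hn
    have hsplit : e n = ∑ m ∈ Finset.range n,
        (Complex.log (1 + δ n / (a + m)) - δ n / (a + m)) +
          δ n * ((∑ m ∈ Finset.range n, (a + m)⁻¹ - Real.log n : ℝ) : ℂ) := by
      simp only [e, Finset.sum_sub_distrib]
      push_cast
      rw [mul_sub, Finset.mul_sum]
      simp only [div_eq_mul_inv]
      ring
    rw [hsplit]
    refine (norm_add_le _ _).trans (add_le_add ?_ ?_)
    · refine (norm_sum_le _ _).trans ((Finset.sum_le_sum (g := fun m : ℕ =>
        ‖δ n‖ ^ 2 * ((a + m) ^ 2)⁻¹) fun m _ => ?_).trans ?_)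
      · have hw : ‖δ n / (a + m)‖ = ‖δ n‖ * (a + m)⁻¹ := by
          rw [norm_div, div_eq_mul_inv]
          congr 2
          have := Complex.norm_of_nonneg (hpos m).le
          push_cast at this
          exact this
        have hw2 : ‖δ n / (a + m)‖ ≤ 1 / 2 := by
          rw [hw, ← div_eq_mul_inv, div_le_iff₀ (hpos m)]
          have : (0 : ℝ) ≤ m := m.cast_nonneg
          linarith
        refine (Complex.norm_log_one_add_sub_self_le (hw2.trans_lt (by norm_num))).trans ?_
        have hinv : (1 - ‖δ n / (a + m)‖)⁻¹ ≤ 2 := by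
          rw [inv_le_comm₀ (by linarith) (by norm_num)]
          linarith
        rw [← inv_pow, ← mul_pow, ← hw]
        nlinarith [sq_nonneg ‖δ n / (a + m)‖]
      · rw [← Finset.mul_sum]
        gcongr
        exact hA n
    · rw [norm_mul, Complex.norm_real]
      gcongr
      exact hB n
  have hexp := (Complex.continuous_exp.tendsto 0).comp he
  rw [Complex.exp_zero] at hexp
  refine hexp.congr' ?_
  -- This keeps every factor a + m + δ nonzero, so that exp inverts log.
  have hsmall : ∀ᶠ n in atTop, ‖δ n‖ < a := by
    have h := hδ.norm
    rw [norm_zero] at h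
    exact h.eventually (gt_mem_nhds ha)
  filter_upwards [hsmall] with n hn
  simp only [Function.comp_apply, e, sub_eq_add_neg, Complex.exp_add, Complex.exp_sum]
  rw [← Finset.prod_div_distrib]
  congr 1
  refine Finset.prod_congr rfl fun m _ => ?_
  have h0 : 1 + δ n / (a + m) = (a + m + δ n) / (a + m) := by
    field_simp [hne m]
  rw [Complex.exp_log, h0]
  rw [h0]
  refine div_ne_zero (fun h => ?_) (hne m)
  have h1 : δ n = -((a + m : ℝ) : ℂ) := by
    push_cast
    linear_combination h
  have h2 : ‖δ n‖ = a + m := by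
    rw [h1, norm_neg, Complex.norm_of_nonneg (hpos m).le]
  have : (0 : ℝ) ≤ m := m.cast_nonneg
  linarith

theorem prod_range_add_mul_add (a : ℝ) (n : ℕ) :
    (∏ m ∈ Finset.range n, (a + m)) * (a + n) = a * ∏ m ∈ Finset.range n, (a + 1 + m) := by
  rw [← Finset.prod_range_succ, Finset.prod_range_succ', mul_comm]
  push_cast
  simp only [add_zero, add_comm (1 : ℝ), add_assoc]

theorem norm_exp_mul_I_sub_le {s : ℝ} (hs : |s| ≤ 1) :
    ‖Complex.exp (s * Complex.I) - 1 - s * Complex.I + (s : ℂ) ^ 2 / 2‖ ≤ |s| ^ 3 := by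
  have hn : ‖(s : ℂ) * Complex.I‖ = |s| := by simp
  have h := Complex.exp_bound (x := s * Complex.I) (by rw [hn]; exact hs) (n := 3) (by norm_num)
  rw [hn] at h
  simp only [Finset.sum_range_succ, Finset.sum_range_zero] at h
  norm_num [Nat.factorial] at h
  have h3 : 0 ≤ |s| ^ 3 := by positivity
  refine le_trans (le_of_eq ?_) (h.trans (by linarith))
  congr 1
  rw [mul_pow, Complex.I_sq]
  ring

/-- Normal limit of the standardised Poisson law with mean L: with s = t/√L, the Taylor remainder
costs at most L|s|³ = t²|s|. -/
theorem tendsto_exp_mul_exp_sub_one {L : ℕ → ℝ} (hL : Tendsto L atTop atTop) (t : ℝ) :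
    Tendsto (fun n => Complex.exp (L n * (Complex.exp ((t / √(L n) : ℝ) * Complex.I) - 1) -
      (t * √(L n) : ℝ) * Complex.I)) atTop (𝓝 (Complex.exp (-(t ^ 2 / 2)))) := by
  refine (Complex.continuous_exp.tendsto _).comp ?_
  have hs : Tendsto (fun n => t / √(L n)) atTop (𝓝 0) :=
    tendsto_const_nhds.div_atTop (Real.tendsto_sqrt_atTop.comp hL)
  have hs' : Tendsto (fun n => |t / √(L n)|) atTop (𝓝 0) := by simpa using hs.abs
  rw [tendsto_iff_norm_sub_tendsto_zero]
  refine squeeze_zero' (Eventually.of_forall fun n => norm_nonneg _) ?_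
    (by simpa using hs'.const_mul (t ^ 2))
  filter_upwards [hs'.eventually (gt_mem_nhds one_pos), hL.eventually_gt_atTop 0] with n h1 h0
  have hq : L n = √(L n) ^ 2 := (Real.sq_sqrt h0.le).symm
  have hq0 : 0 < √(L n) := Real.sqrt_pos.2 h0
  have e1 : L n * (t / √(L n)) ^ 2 = t ^ 2 := by
    rw [div_pow, ← hq]
    field_simp
  have e2 : L n * (t / √(L n)) = t * √(L n) := by
    nth_rw 1 [hq]
    field_simp
  have e1' := congrArg (fun x : ℝ => (x : ℂ)) e1
  have e2' := congrArg (fun x : ℝ => (x : ℂ)) e2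
  calc _ = ‖(L n : ℂ) * (Complex.exp ((t / √(L n) : ℝ) * Complex.I) - 1 -
        (t / √(L n) : ℝ) * Complex.I + ((t / √(L n) : ℝ) : ℂ) ^ 2 / 2)‖ := by
        congr 1
        push_cast at e1' e2' ⊢
        linear_combination (-1 / 2) * e1' + Complex.I * e2'
    _ ≤ L n * |t / √(L n)| ^ 3 := by
        rw [norm_mul, Complex.norm_of_nonneg h0.le]
        gcongr
        exact norm_exp_mul_I_sub_le h1.le
    _ = _ := by
        rw [pow_succ, sq_abs, ← mul_assoc, e1]

/-- Factorwise |w + m| ≤ a - 1 + m, and the resulting ratio telescopes to (a-1)/(a-1+n). -/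
theorem tendsto_prod_div_prod_zero {a : ℝ} (ha : 0 < a) {w : ℕ → ℂ}
    (hw : ∀ n, ‖w n‖ ≤ a - 1) :
    Tendsto (fun n : ℕ => (∏ m ∈ Finset.range n, (w n + m)) /
      (∏ m ∈ Finset.range n, ((a : ℂ) + m))) atTop (𝓝 0) := by
  have hb : 0 ≤ a - 1 := (norm_nonneg _).trans (hw 0)
  have hlim : Tendsto (fun n : ℕ => (a - 1) / (a - 1 + n)) atTop (𝓝 0) :=
    tendsto_const_nhds.div_atTop
      (tendsto_atTop_add_const_left _ _ tendsto_natCast_atTop_atTop)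
  refine squeeze_zero_norm' ?_ hlim
  filter_upwards [eventually_gt_atTop 0] with n hn
  have hn' : (0 : ℝ) < n := Nat.cast_pos.2 hn
  have hD : ‖∏ m ∈ Finset.range n, ((a : ℂ) + m)‖ = ∏ m ∈ Finset.range n, (a + m) := by
    rw [norm_prod]
    refine Finset.prod_congr rfl fun m _ => ?_
    have := Complex.norm_of_nonneg (show 0 ≤ a + m by positivity)
    push_cast at this
    exact this
  have hDpos : 0 < ∏ m ∈ Finset.range n, (a + m) := Finset.prod_pos fun m _ => by positivity
  rw [norm_div, hD, div_le_div_iff₀ hDpos (by positivity)]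
  have h := prod_range_add_mul_add (a - 1) n
  simp only [sub_add_cancel] at h
  rw [← h, norm_prod]
  refine mul_le_mul_of_nonneg_right (Finset.prod_le_prod (fun m _ => norm_nonneg _) fun m _ => ?_)
    (by positivity)
  refine (norm_add_le _ _).trans ?_
  rw [Complex.norm_natCast]
  linarith [hw n]

/-! ### Dominance of the term i = k -/

theorem tendsto_rLahGen_sub {r : ℝ} (hr : 0 ≤ r) {k : ℕ} (ha : 0 < r + k + r) {x : ℕ → ℂ}
    (hx : ∀ n, ‖x n‖ = 1) :
    Tendsto (fun n : ℕ => (k.factorial : ℂ) * rLahGen r n k (x n) /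
        (∏ m ∈ Finset.range n, (((r + k + r : ℝ) : ℂ) + m)) -
      (∏ m ∈ Finset.range n, ((r + k) * x n + r + m)) /
        (∏ m ∈ Finset.range n, (((r + k + r : ℝ) : ℂ) + m))) atTop (𝓝 0) := by
  have key : Tendsto (fun n : ℕ => ∑ i ∈ Finset.range k, (-1) ^ (k + i) * (k.choose i : ℂ) *
      ((∏ m ∈ Finset.range n, ((r + i) * x n + r + m)) /
        (∏ m ∈ Finset.range n, (((r + k + r : ℝ) : ℂ) + m)))) atTop (𝓝 0) := by
    rw [← Finset.sum_const_zero (s := Finset.range k)]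
    refine tendsto_finsetSum _ fun i hi => ?_
    rw [← mul_zero ((-1) ^ (k + i) * (k.choose i : ℂ))]
    refine (tendsto_prod_div_prod_zero ha fun n => ?_).const_mul _
    have hi' : (i : ℝ) + 1 ≤ k := by exact_mod_cast Finset.mem_range.1 hi
    have h1 : ‖(r : ℂ) + i‖ = r + i := by
      have := Complex.norm_of_nonneg (show 0 ≤ r + i by positivity)
      push_cast at this
      exact this
    refine (norm_add_le _ _).trans ?_
    rw [norm_mul, hx, h1, Complex.norm_of_nonneg hr]
    linarith
  refine key.congr fun n => ?_
  rw [factorial_mul_rLahGen, Finset.sum_range_succ, ← two_mul]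
  simp only [pow_mul, Nat.choose_self, mul_div_assoc, Finset.sum_div, add_div]
  norm_num

/-- The unimodular `u` carries the centring phase; it leaves the error term negligible. -/
theorem tendsto_rLahGen_div_mul_exp {r : ℝ} (hr : 0 ≤ r) {k : ℕ} (hc : 0 < (k : ℝ) + r)
    {x : ℕ → ℂ} (hx : ∀ n, ‖x n‖ = 1) (hx1 : Tendsto x atTop (𝓝 1)) {u : ℕ → ℂ}
    (hu : ∀ n, ‖u n‖ = 1) {ℓ : ℂ}
    (hℓ : Tendsto (fun n : ℕ => Complex.exp (((k : ℂ) + r) * (x n - 1) * Real.log n) * u n)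
      atTop (𝓝 ℓ)) :
    Tendsto (fun n : ℕ => (k.factorial : ℂ) * rLahGen r n k (x n) /
        (∏ m ∈ Finset.range n, (((r + k + r : ℝ) : ℂ) + m)) * u n) atTop (𝓝 ℓ) := by
  have ha : 0 < r + k + r := by linarith
  have h1 := tendsto_rLahGen_sub hr ha hx
  have h1u : Tendsto (fun n : ℕ => ((k.factorial : ℂ) * rLahGen r n k (x n) /
        (∏ m ∈ Finset.range n, (((r + k + r : ℝ) : ℂ) + m)) -
      (∏ m ∈ Finset.range n, ((r + k) * x n + r + m)) /
        (∏ m ∈ Finset.range n, (((r + k + r : ℝ) : ℂ) + m))) * u n) atTop (𝓝 0) := by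
    rw [tendsto_zero_iff_norm_tendsto_zero] at h1 ⊢
    simpa [norm_mul, hu] using h1
  have hδ : Tendsto (fun n => ((k : ℂ) + r) * (x n - 1)) atTop (𝓝 0) := by
    simpa using (hx1.sub_const 1).const_mul ((k : ℂ) + r)
  have h2 := (tendsto_prod_add_div_prod_mul_exp ha hδ).mul hℓ
  have h3 := h1u.add h2
  rw [one_mul, zero_add] at h3
  refine h3.congr fun n => ?_
  have hprod : ∏ m ∈ Finset.range n, (((r + k + r : ℝ) : ℂ) + m + ((k : ℂ) + r) * (x n - 1)) =
      ∏ m ∈ Finset.range n, (((r : ℂ) + k) * x n + r + m) := by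
    refine Finset.prod_congr rfl fun m _ => ?_
    push_cast
    ring
  rw [hprod]
  have he : Complex.exp (-(((k : ℂ) + r) * (x n - 1) * Real.log n)) *
      Complex.exp (((k : ℂ) + r) * (x n - 1) * Real.log n) = 1 := by
    rw [← Complex.exp_add, neg_add_cancel, Complex.exp_zero]
  linear_combination ((∏ m ∈ Finset.range n, (((r : ℂ) + k) * x n + r + m)) /
    (∏ m ∈ Finset.range n, (((r + k + r : ℝ) : ℂ) + m)) * u n) * he

/-! ### Characteristic functions and the limit theorem -/

theorem HasRLahDistribution.integral_comp {Ω : Type*} [MeasurableSpace Ω] {P : Measure Ω}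
    [IsProbabilityMeasure P] {X : Ω → ℝ} {n k : ℕ} {r : ℝ} (h : HasRLahDistribution P X n k r)
    (hL : rLah r n k ≠ 0) {g : ℝ → ℂ} (hg : Continuous g) :
    ∫ ω, g (X ω) ∂P = ∑ j ∈ Finset.Icc k n,
      ((rStirlingFirst r n j * rStirlingSecond r j k / rLah r n k : ℝ) : ℂ) * g j := by
  have hX := h.aemeasurable
  have : IsProbabilityMeasure (P.map X) := Measure.isProbabilityMeasure_map hX
  have hp : ∀ j ∈ Finset.Icc k n, (P.map X).real {(j : ℝ)} =
      rStirlingFirst r n j * rStirlingSecond r j k / rLah r n k := fun j hj => by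
    rw [map_measureReal_apply_of_aemeasurable hX (measurableSet_singleton _), ← h.prob_eq j hj]
    rfl
  let S : Finset ℝ := (Finset.Icc k n).map Nat.castEmbedding
  -- The prescribed atoms already have total mass one, so the law has no other mass.
  have hS : (P.map X).real S = 1 := by
    rw [← sum_measureReal_singleton, Finset.sum_map]
    simp only [Nat.castEmbedding_apply]
    rw [Finset.sum_congr rfl hp, ← Finset.sum_div]
    exact div_self hL
  have hae : ∀ᵐ y ∂(P.map X), y ∈ (S : Set ℝ) := by
    rw [measureReal_def] at hS
    exact (mem_ae_iff_prob_eq_one S.measurableSet).2 ((ENNReal.toReal_eq_one_iff _).1 hS)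
  rw [← integral_map hX hg.aestronglyMeasurable, ← Measure.restrict_eq_self_of_ae_mem hae,
    setIntegral_finset]
  · rw [Finset.sum_map]
    refine Finset.sum_congr rfl fun j hj => ?_
    rw [Nat.castEmbedding_apply, hp j hj, Complex.real_smul]
  · exact IntegrableOn.finset

theorem HasRLahDistribution.charFun_normalized {Ω : Type*} [MeasurableSpace Ω] {P : Measure Ω}
    [IsProbabilityMeasure P] {X : Ω → ℝ} {n k : ℕ} {r : ℝ} (h : HasRLahDistribution P X n k r)
    (hL : rLah r n k ≠ 0) {v : ℝ} (hv : 0 < v) (t : ℝ) :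
    charFun (P.map fun ω => (X ω - v) / √v) t =
      rLahGen r n k (Complex.exp ((t / √v : ℝ) * Complex.I)) / rLahGen r n k 1 *
        Complex.exp (-((t * √v : ℝ) * Complex.I)) := by
  have hX := h.aemeasurable
  rw [charFun_apply_real, integral_map (by fun_prop) (by fun_prop)]
  rw [h.integral_comp hL (g := fun y => Complex.exp (t * (((y - v) / √v : ℝ) : ℂ) * Complex.I))
    (by fun_prop), rLahGen_one, rLahGen, Finset.sum_div, Finset.sum_mul]
  refine Finset.sum_congr rfl fun j _ => ?_
  have hq0 : 0 < √v := Real.sqrt_pos.2 hv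
  have e : t * ((j - v) / √v) = j * (t / √v) - t * √v := by
    field_simp
    rw [Real.sq_sqrt hv.le]
  have e' : (t : ℂ) * (((j - v) / √v : ℝ) : ℂ) * Complex.I =
      j * ((t / √v : ℝ) * Complex.I) + -((t * √v : ℝ) * Complex.I) := by
    have := congrArg (fun x : ℝ => (x : ℂ)) e
    push_cast at this ⊢
    linear_combination Complex.I * this
  rw [e', Complex.exp_add, Complex.exp_nat_mul]
  push_cast
  ring

theorem mainTheorem2 (k : ℕ) (r : ℝ) (hr : 0 ≤ r) (hkr : 0 < max (k : ℝ) r)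
    {Ω : ℕ → Type*} [∀ n, MeasurableSpace (Ω n)] (P : ∀ n, Measure (Ω n))
    [∀ n, IsProbabilityMeasure (P n)] (X : ∀ n, Ω n → ℝ) (hX : ∀ n, AEMeasurable (X n) (P n))
    (hLah : ∀ n : ℕ, 1 ≤ n → k ≤ n → HasRLahDistribution (P n) (X n) n k r)
    {Ω' : Type*} [MeasurableSpace Ω'] (P' : Measure Ω') [IsProbabilityMeasure P']
    (Z : Ω' → ℝ) (hZ : HasLaw Z (gaussianReal 0 1) P') :
    TendstoInDistribution
      (fun (n : ℕ) (ω : Ω n) =>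
        (X n ω - ((k : ℝ) + r) * Real.log n) / Real.sqrt (((k : ℝ) + r) * Real.log n))
      atTop Z P P' := by
  have hc : 0 < (k : ℝ) + r := hkr.trans_le
    (max_le (le_add_of_nonneg_right hr) (le_add_of_nonneg_left k.cast_nonneg))
  have hv : Tendsto (fun n : ℕ => ((k : ℝ) + r) * Real.log n) atTop atTop :=
    (Real.tendsto_log_atTop.comp tendsto_natCast_atTop_atTop).const_mul_atTop hc
  -- The case x = 1 handles the normalising constant; its limit 1 also shows that `rLah r n k` is
  -- eventually nonzero.
  have hden := tendsto_rLahGen_div_mul_exp hr hc (x := fun _ => 1) (by simp)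
    tendsto_const_nhds (u := fun _ => 1) (by simp) (ℓ := 1) (by simp)
  simp only [mul_one] at hden
  refine ⟨fun n => ((hX n).sub_const _).div_const _, hZ.aemeasurable, ?_⟩
  refine ProbabilityMeasure.tendsto_iff_tendsto_charFun.2 fun t => ?_
  have hs : Tendsto (fun n : ℕ => t / √(((k : ℝ) + r) * Real.log n)) atTop (𝓝 0) :=
    tendsto_const_nhds.div_atTop (Real.tendsto_sqrt_atTop.comp hv)
  have hx1 : Tendsto (fun n : ℕ =>
      Complex.exp ((t / √(((k : ℝ) + r) * Real.log n) : ℝ) * Complex.I)) atTop (𝓝 1) := by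
    have hcont : Continuous fun s : ℝ => Complex.exp (s * Complex.I) := by fun_prop
    have h := (hcont.tendsto 0).comp hs
    simp only [Complex.ofReal_zero, zero_mul, Complex.exp_zero] at h
    exact h
  have hnum := tendsto_rLahGen_div_mul_exp hr hc
    (fun n => Complex.norm_exp_ofReal_mul_I _) hx1
    (u := fun n : ℕ => Complex.exp (-((t * √(((k : ℝ) + r) * Real.log n) : ℝ) * Complex.I)))
    (fun n => by rw [← neg_mul, ← Complex.ofReal_neg, Complex.norm_exp_ofReal_mul_I])
    (ℓ := Complex.exp (-(t ^ 2 / 2))) (by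
      refine (tendsto_exp_mul_exp_sub_one hv t).congr fun n => ?_
      rw [sub_eq_add_neg _ ((t * _ : ℝ) * Complex.I), Complex.exp_add]
      congr 2
      push_cast
      ring)
  have hlim := hnum.div hden one_ne_zero
  rw [div_one] at hlim
  have hgauss : charFun (P'.map Z) t = Complex.exp (-(t ^ 2 / 2)) := by
    rw [hZ.map_eq, charFun_gaussianReal]
    simp
  change Tendsto (fun n => charFun ((P n).map _) t) atTop (𝓝 (charFun (P'.map Z) t))
  rw [hgauss]
  refine hlim.congr' ?_
  filter_upwards [eventually_ge_atTop 1, eventually_ge_atTop k, hv.eventually_gt_atTop 0,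
    hden.eventually_ne one_ne_zero] with n h1 hk hpos hne
  have hQ : rLahGen r n k 1 ≠ 0 := fun h => hne (by simp [h])
  have hL : rLah r n k ≠ 0 := fun h => hQ (by rw [rLahGen_one, h, Complex.ofReal_zero])
  have hD : ∏ m ∈ Finset.range n, (((r + k + r : ℝ) : ℂ) + m) ≠ 0 := fun h => hne (by rw [h, div_zero])
  have hf : (k.factorial : ℂ) ≠ 0 := Nat.cast_ne_zero.2 k.factorial_ne_zero
  rw [(hLah n h1 hk).charFun_normalized hL hpos, Pi.div_apply]
  field_simp
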